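/- Let $\Omega=(0,1)^3$, let $T>0$, and let $\lambda,\mu$ be real constants with $\mu>0$ and $\lambda+2\mu>0$. Let $\varphi\in L^1(0,T)$, $X=(X_1,X_2,X_3)\in (L^1(0,T;L^1(\partial\Omega)))^3$ and $g,h\in (L^2(\Omega))^3$ be given data. Consider, for the unknowns $u=(u_1,u_2,u_3)$ and $f=(f_1,f_2,f_3)$, the system $$\frac{\partial^2u}{\partial t^2}-\mu\Delta u-(\lambda+\mu)\nabla(\operatorname{div}u)=\varphi(t)f(x)\quad\text{in }\Omega\times(0,T),$$ $$u(\cdot,0)=g,\qquad \frac{\partial u}{\partial t}(\cdot,0)=h\quad\text{in }\Omega,$$ $$u=0\quad\text{on }\partial\Omega\times(0,T),\qquad \sum_{k=1}^3\sigma_{jk}\,\mathbf n_k=X_j\quad\text{on }\partial\Omega\times(0,T),\ j=1,2,3,$$ where $\mathbf n$ is the outward unit normal of $\partial\Omega$ and the stress tensor is $\sigma_{jj}=\lambda\operatorname{div}u+2\mu\,\partial u_j/\partial x_j$ and $\sigma_{jk}=\mu(\partial u_j/\partial x_k+\partial u_k/\partial x_j)$ for $j\neq k$. Here the differential equation holds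 in $L^2(\Omega)$ for almost every $t$, with weak space derivatives, and the boundary conditions hold in the sense of traces for almost every $t$. Assume: (W1) there exist $\Lambda\in(0,T)$ and $C>0$ such that either $\varphi(t)\ge C$ for a.e. $t\in(0,\Lambda)$, or $\varphi(t)\le -C$ for a.e. $t\in(0,\Lambda)$; (W2) $T>2\max\left\{\dfrac1{\sqrt\mu},\dfrac1{\sqrt{\lambda+2\mu}}\right\}$. Then the system has at most one solution $$(u,f)\in\big(C^2([0,T];L^2(\Omega))\cap L^2(0,T;H^2(\Omega))\big)^3\times (L^2(\Omega))^3 .$$ -/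

import Mathlib

open MeasureTheory Set Filter Topology
open scoped ContDiff ENNReal

noncomputable section

namespace Lame

/-- The open unit cube `Ω = (0,1)³`. -/
def unitCube : Set (Fin 3 → ℝ) := Set.univ.pi fun _ => Ioo (0 : ℝ) 1

/-- The open unit square `(0,1)²`, which parametrizes each face of the cube. -/
def unitSquare : Set (Fin 2 → ℝ) := Set.univ.pi fun _ => Ioo (0 : ℝ) 1

/-- The real Hilbert space `L²(Ω)`. -/
abbrev L2 : Type := Lp ℝ 2 (volume.restrict unitCube)

/-- The surface measure `dω` on `∂Ω`: the sum, over the six faces `{x i = s}` with `i = 0, 1, 2`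
and `s = 0, 1`, of the two-dimensional Lebesgue measure. -/
def surfaceMeasure : Measure (Fin 3 → ℝ) :=
  ∑ i : Fin 3, ∑ s ∈ ({0, 1} : Finset ℝ),
    (volume.restrict unitSquare).map (fun y : Fin 2 → ℝ => i.insertNth (α := fun _ => ℝ) s y)

/-- The outward unit normal of `∂Ω`. On the edges, a null set for the surface measure,
the value is immaterial. -/
def outwardNormal (x : Fin 3 → ℝ) (i : Fin 3) : ℝ :=
  if x i = 1 then 1 else if x i = 0 then -1 else 0

/-- The classical partial derivative `∂ψ/∂x_i`. -/
def partialDeriv (i : Fin 3) (ψ : (Fin 3 → ℝ) → ℝ) (x : Fin 3 → ℝ) : ℝ :=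
  fderiv ℝ ψ x (Pi.single i 1)

/-- `w ∈ L²(Ω)` is the weak partial derivative `∂v/∂x_i` of `v ∈ L²(Ω)`. -/
def HasWeakPartial (i : Fin 3) (v w : L2) : Prop :=
  ∀ ψ : (Fin 3 → ℝ) → ℝ, ContDiff ℝ ∞ ψ → HasCompactSupport ψ → tsupport ψ ⊆ unitCube →
    ∫ x in unitCube, v x * partialDeriv i ψ x = - ∫ x in unitCube, w x * ψ x

open Classical in
/-- The weak partial derivative `∂v/∂x_i ∈ L²(Ω)` (and `0` if `v` has none in `L²(Ω)`). -/
def weakPartial (i : Fin 3) (v : L2) : L2 :=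
  if h : ∃ w, HasWeakPartial i v w then h.choose else 0

theorem HasWeakPartial.unique {i : Fin 3} {v w w' : L2}
    (h : HasWeakPartial i v w) (h' : HasWeakPartial i v w') : w = w' := by
  have hopen : IsOpen unitCube := isOpen_set_pi finite_univ fun _ _ => isOpen_Ioo
  have hfin : volume unitCube ≠ ⊤ := by
    unfold unitCube
    rw [Real.volume_pi_Ioo]
    simp
  have : IsFiniteMeasure (volume.restrict unitCube) := ⟨by
    rw [Measure.restrict_apply_univ]; exact hfin.lt_top⟩
  have hw : IntegrableOn (w : (Fin 3 → ℝ) → ℝ) unitCube := (Lp.memLp w).integrable (by norm_num)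
  have hw' : IntegrableOn (w' : (Fin 3 → ℝ) → ℝ) unitCube :=
    (Lp.memLp w').integrable (by norm_num)
  have key := hopen.ae_eq_zero_of_integral_contDiff_smul_eq_zero (μ := volume)
    (f := fun x => w x - w' x) (hw.sub hw').locallyIntegrableOn (by
      intro ψ h1 h2 h3
      have e := (h ψ h1 h2 h3).symm.trans (h' ψ h1 h2 h3)
      have e' := neg_injective e
      obtain ⟨C, hC⟩ := h2.exists_bound_of_continuous h1.continuous
      have i1 : IntegrableOn (fun x => w x * ψ x) unitCube :=
        Integrable.mul_bdd (c := C) hw h1.continuous.aestronglyMeasurable (ae_of_all _ hC)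
      have i2 : IntegrableOn (fun x => w' x * ψ x) unitCube :=
        Integrable.mul_bdd (c := C) hw' h1.continuous.aestronglyMeasurable (ae_of_all _ hC)
      have z : ∫ x in unitCube, ψ x • (w x - w' x) = 0 := by
        have : ∀ x, ψ x • (w x - w' x) = w x * ψ x - w' x * ψ x := fun x => by
          simp only [smul_eq_mul]; ring
        simp only [this]
        rw [integral_sub i1 i2, e', sub_self]
      rw [← z]
      symm
      apply setIntegral_eq_integral_of_forall_compl_eq_zero
      intro x hx
      have : ψ x = 0 := by
        by_contra hne
        exact hx (h3 (subset_tsupport ψ hne))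
      simp [this])
  apply Lp.ext
  rw [Filter.EventuallyEq, ae_restrict_iff' hopen.measurableSet]
  filter_upwards [key] with x hx hm
  exact sub_eq_zero.mp (hx hm)

theorem HasWeakPartial.weakPartial_eq {i : Fin 3} {v w : L2} (h : HasWeakPartial i v w) :
    weakPartial i v = w := by
  have hex : ∃ w, HasWeakPartial i v w := ⟨w, h⟩
  unfold weakPartial
  rw [dif_pos hex]
  exact hex.choose_spec.unique h

/-- `v ∈ H¹(Ω)`. -/
def MemH1 (v : L2) : Prop := ∀ i, ∃ w, HasWeakPartial i v w

/-- `v ∈ H²(Ω)`. -/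
def MemH2 (v : L2) : Prop := MemH1 v ∧ ∀ i, MemH1 (weakPartial i v)

/-- `v ∈ L²(0,T;H²(Ω))`: the values are in `H²(Ω)` for a.e. `t`, and `v` and all its first and
second order space derivatives are in the Bochner space `L²(0,T;L²(Ω))`. -/
structure MemL2H2 (T : ℝ) (v : ℝ → L2) : Prop where
  memH2 : ∀ᵐ t ∂volume.restrict (Ioo 0 T), MemH2 (v t)
  memLp : MemLp v 2 (volume.restrict (Ioo 0 T))
  memLp_first : ∀ i, MemLp (fun t => weakPartial i (v t)) 2 (volume.restrict (Ioo 0 T))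
  memLp_second : ∀ i j,
    MemLp (fun t => weakPartial j (weakPartial i (v t))) 2 (volume.restrict (Ioo 0 T))

/-- `γ ∈ L²(∂Ω)` is the trace on `∂Ω` of `v ∈ H¹(Ω)`: some sequence of functions that are smooth
up to the boundary tends to `v` in `H¹(Ω)`, and its restrictions to `∂Ω` tend to `γ` in
`L²(∂Ω)`. -/
def HasTrace (v : L2) (γ : Lp ℝ 2 surfaceMeasure) : Prop :=
  MemH1 v ∧ ∃ w : ℕ → (Fin 3 → ℝ) → ℝ, (∀ n, ContDiff ℝ ∞ (w n)) ∧
    Tendsto (fun n => eLpNorm (fun x => w n x - v x) 2 (volume.restrict unitCube)) atTop (𝓝 0) ∧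
    (∀ i, Tendsto (fun n => eLpNorm (fun x => partialDeriv i (w n) x - weakPartial i v x) 2
      (volume.restrict unitCube)) atTop (𝓝 0)) ∧
    Tendsto (fun n => eLpNorm (fun x => w n x - γ x) 2 surfaceMeasure) atTop (𝓝 0)

/-- The divergence `div v`. -/
def divergence (v : Fin 3 → L2) : L2 := ∑ i, weakPartial i (v i)

/-- The Laplacian `Δ v`. -/
def laplacian (v : L2) : L2 := ∑ i, weakPartial i (weakPartial i v)

/-- The stress tensor: `σ_j = lam div v + 2 mu ∂v_j/∂x_j` on the diagonal, and
`τ_{jk} = mu (∂v_j/∂x_k + ∂v_k/∂x_j)` off the diagonal. -/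
def stress (lam mu : ℝ) (v : Fin 3 → L2) (j k : Fin 3) : L2 :=
  if j = k then lam • divergence v + (2 * mu) • weakPartial j (v j)
  else mu • (weakPartial k (v j) + weakPartial j (v k))

/-- `(u,f)` with `u ∈ (C²([0,T];L²(Ω)) ∩ L²(0,T;H²(Ω)))³` and `f ∈ L²(Ω)³` solves the Lamé system
with body force `φ(t) f(x)`, clamped boundary, initial data `g`, `h` and surface stress `X`.
Only the values `u t` with `t ∈ [0,T]` matter. -/
structure IsSolution (lam mu T : ℝ) (φ : ℝ → ℝ) (X : ℝ → Fin 3 → Lp ℝ 1 surfaceMeasure)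
    (g h : Fin 3 → L2) (u : ℝ → Fin 3 → L2) (f : Fin 3 → L2) : Prop where
  contDiffOn : ContDiffOn ℝ 2 u (Icc 0 T)
  memL2H2 : ∀ k, MemL2H2 T fun t => u t k
  equation : ∀ᵐ t ∂volume.restrict (Ioo 0 T), ∀ k,
    iteratedDerivWithin 2 u (Icc 0 T) t k - mu • laplacian (u t k)
      - (lam + mu) • weakPartial k (divergence (u t)) = φ t • f k
  initial_value : u 0 = g
  initial_velocity : derivWithin u (Icc 0 T) 0 = h
  clamped : ∀ᵐ t ∂volume.restrict (Ioo 0 T), ∀ k, HasTrace (u t k) 0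
  surface_stress : ∀ᵐ t ∂volume.restrict (Ioo 0 T),
    ∃ τ : Fin 3 → Fin 3 → Lp ℝ 2 surfaceMeasure,
      (∀ j k, HasTrace (stress lam mu (u t) j k) (τ j k)) ∧
      ∀ j, ∀ᵐ x ∂surfaceMeasure, ∑ k, τ j k x * outwardNormal x k = X t j x

end Lame

end

/-!
The difference of two solutions is tested against the real exponential waves `a exp (α · x)`, with
`a` parallel to `α` (longitudinal modes, `κ = lam + 2 mu`) or orthogonal to `α` (transverse modes,
`κ = mu`). These are eigenfunctions of the Lamé operator with eigenvalue `c² = κ |α|²`. Both the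
displacement and the surface stress are prescribed on the whole boundary, so all boundary terms of
the difference cancel in Betti's formula (`waveFunctional_lame`), and the mode `W` of the difference
of the displacements satisfies `W'' = c² W + φ Φ`, where `Φ = Φ(α)` is the mode of the difference of
the body forces, with zero initial data. Since `W' + c W` solves a first order equation,
`(W' + c W)(t) exp (-c t) = Φ ∫₀ᵗ φ(s) exp (-c s) ds` (`exp_mul_eq_integral_of_ode`).

Replace `α` by `s • α` with positive `α i` and let `s → ∞`, so that `c = s √κ |α|`. On the right,
the sign condition on `φ` near `0` bounds the integral from below by a multiple of `1 / s`
(`exists_le_mul_abs_integral_exp`). On the left, at `t = T`, the growth `exp (s ∑ i, α i)` of the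
wave on the cube loses against `exp (-s √κ |α| T)`, because `∑ i, α i ≤ √3 |α|` and `√κ T > 2`. Hence
`Φ(s • α) → 0`. But `s ↦ Φ(s • α)` extends to an entire function of exponential type that is bounded
on the left half-plane, so by the Phragmén–Lindelöf principle and Liouville's theorem it vanishes
identically (`integral_mul_exp_eq_zero_of_tendsto`).

So the difference of the body forces is orthogonal to all longitudinal and transverse waves with
positive wave vector. These span a dense subspace of `L²(Ω)³`, by the Stone–Weierstrass theorem
(`eq_zero_of_waveFunctional_eq_zero`), and the body forces agree. Then `Φ = 0`, the formula gives
`W' + c W = 0` at all times, so `W = 0` for every mode, and the displacements agree as well.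
-/

namespace Lame

/-! ### The cube, its boundary, and their measures -/

theorem isOpen_unitCube : IsOpen unitCube :=
  isOpen_set_pi finite_univ fun _ _ => isOpen_Ioo

theorem unitCube_ae_eq_Icc : unitCube =ᵐ[volume] Icc (0 : Fin 3 → ℝ) 1 := by
  unfold unitCube
  exact Measure.univ_pi_Ioo_ae_eq_Icc (μ := fun _ : Fin 3 => (volume : Measure ℝ))
    (f := 0) (g := 1)

theorem unitSquare_ae_eq_Icc : unitSquare =ᵐ[volume] Icc (0 : Fin 2 → ℝ) 1 := by
  unfold unitSquare
  exact Measure.univ_pi_Ioo_ae_eq_Icc (μ := fun _ : Fin 2 => (volume : Measure ℝ))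
    (f := 0) (g := 1)

theorem mem_Icc_of_mem_unitCube {x : Fin 3 → ℝ} (hx : x ∈ unitCube) :
    x ∈ Icc (0 : Fin 3 → ℝ) 1 :=
  ⟨fun i => (hx i (mem_univ i)).1.le, fun i => (hx i (mem_univ i)).2.le⟩

theorem ae_mem_Icc_unitCube :
    ∀ᵐ x ∂volume.restrict unitCube, x ∈ Icc (0 : Fin 3 → ℝ) 1 :=
  (ae_restrict_mem isOpen_unitCube.measurableSet).mono fun _ => mem_Icc_of_mem_unitCube

instance isFiniteMeasure_restrict_unitCube : IsFiniteMeasure (volume.restrict unitCube) := ⟨by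
  rw [Measure.restrict_apply_univ, unitCube, Real.volume_pi_Ioo]
  simp⟩

instance isFiniteMeasure_restrict_unitSquare : IsFiniteMeasure (volume.restrict unitSquare) := ⟨by
  rw [Measure.restrict_apply_univ, unitSquare, Real.volume_pi_Ioo]
  simp⟩

instance isFiniteMeasure_surfaceMeasure : IsFiniteMeasure surfaceMeasure := by
  unfold surfaceMeasure
  infer_instance

theorem continuous_insertNth (i : Fin 3) (s : ℝ) :
    Continuous fun y : Fin 2 → ℝ => i.insertNth (α := fun _ => ℝ) s y :=
  continuous_const.finInsertNth i continuous_id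

theorem ae_surfaceMeasure_of_faces {p : (Fin 3 → ℝ) → Prop} (hp : MeasurableSet {x | p x})
    (h : ∀ (i : Fin 3), ∀ s ∈ ({0, 1} : Finset ℝ), ∀ y ∈ unitSquare,
      p (i.insertNth (α := fun _ => ℝ) s y)) : ∀ᵐ x ∂surfaceMeasure, p x := by
  have hsq : MeasurableSet unitSquare :=
    (isOpen_set_pi finite_univ fun _ _ => isOpen_Ioo).measurableSet
  rw [ae_iff, surfaceMeasure, Measure.finsetSum_apply]
  refine Finset.sum_eq_zero fun i _ => ?_
  rw [Measure.finsetSum_apply]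
  refine Finset.sum_eq_zero fun s hs => ?_
  rw [← ae_iff, ae_map_iff (continuous_insertNth i s).aemeasurable hp]
  filter_upwards [ae_restrict_mem hsq] with y hy using h i s hs y hy

theorem ae_mem_Icc_surfaceMeasure : ∀ᵐ x ∂surfaceMeasure, x ∈ Icc (0 : Fin 3 → ℝ) 1 := by
  refine ae_surfaceMeasure_of_faces measurableSet_Icc fun i s hs y hy => ?_
  have hs' : 0 ≤ s ∧ s ≤ 1 := by
    rcases Finset.mem_insert.1 hs with rfl | h
    · norm_num
    · rw [Finset.mem_singleton.1 h]; norm_num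
  constructor <;> intro k <;> refine Fin.succAboveCases i ?_ (fun j => ?_) k
  · simpa using hs'.1
  · simpa using (hy j (mem_univ j)).1.le
  · simpa using hs'.2
  · simpa using (hy j (mem_univ j)).2.le

theorem measurable_outwardNormal (i : Fin 3) : Measurable fun x => outwardNormal x i := by
  unfold outwardNormal
  refine Measurable.ite (measurableSet_eq_fun (measurable_pi_apply i) measurable_const)
    measurable_const (Measurable.ite
      (measurableSet_eq_fun (measurable_pi_apply i) measurable_const)
      measurable_const measurable_const)

theorem norm_outwardNormal_le_one (x : Fin 3 → ℝ) (i : Fin 3) : ‖outwardNormal x i‖ ≤ 1 := by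
  unfold outwardNormal
  split_ifs <;> simp

theorem exists_bound_Icc {G : (Fin 3 → ℝ) → ℝ} (hG : Continuous G) :
    ∃ C, ∀ x ∈ Icc (0 : Fin 3 → ℝ) 1, ‖G x‖ ≤ C :=
  isCompact_Icc.exists_bound_of_continuousOn hG.continuousOn

theorem memLp_unitCube_of_continuous {G : (Fin 3 → ℝ) → ℝ} (hG : Continuous G) (p : ℝ≥0∞) :
    MemLp G p (volume.restrict unitCube) := by
  obtain ⟨C, hC⟩ := exists_bound_Icc hG
  exact MemLp.of_bound hG.aestronglyMeasurable C (ae_mem_Icc_unitCube.mono hC)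

theorem memLp_surfaceMeasure_of_continuous {G : (Fin 3 → ℝ) → ℝ} (hG : Continuous G) (p : ℝ≥0∞) :
    MemLp G p surfaceMeasure := by
  obtain ⟨C, hC⟩ := exists_bound_Icc hG
  exact MemLp.of_bound hG.aestronglyMeasurable C (ae_mem_Icc_surfaceMeasure.mono hC)

theorem integral_surfaceMeasure {G : (Fin 3 → ℝ) → ℝ} (hG : Integrable G surfaceMeasure) :
    ∫ x, G x ∂surfaceMeasure = ∑ i : Fin 3, ∑ s ∈ ({0, 1} : Finset ℝ),
      ∫ y in unitSquare, G (i.insertNth (α := fun _ => ℝ) s y) := by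
  have h1 : ∀ i : Fin 3, Integrable G (∑ s ∈ ({0, 1} : Finset ℝ), (volume.restrict unitSquare).map
      (fun y : Fin 2 → ℝ => i.insertNth (α := fun _ => ℝ) s y)) := fun i =>
    (integrable_finsetSum_measure.1 hG) i (Finset.mem_univ i)
  rw [surfaceMeasure, integral_finsetSum_measure fun i _ => h1 i]
  refine Finset.sum_congr rfl fun i _ => ?_
  have h2 := integrable_finsetSum_measure.1 (h1 i)
  rw [integral_finsetSum_measure h2]
  exact Finset.sum_congr rfl fun s hs =>
    integral_map (continuous_insertNth i s).aemeasurable (h2 s hs).aestronglyMeasurable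

/-- The divergence theorem on the cube, for a vector field with a single component. -/
theorem integral_partialDeriv_unitCube (k : Fin 3) {G : (Fin 3 → ℝ) → ℝ} (hG : ContDiff ℝ 1 G) :
    ∫ x in unitCube, partialDeriv k G x = ∫ x, G x * outwardNormal x k ∂surfaceMeasure := by
  have hcont : Continuous (partialDeriv k G) :=
    (hG.continuous_fderiv (by norm_num)).clm_apply continuous_const
  have hint : Integrable (fun x => G x * outwardNormal x k) surfaceMeasure :=
    ((memLp_surfaceMeasure_of_continuous hG.continuous 1).integrable le_rfl).mul_bdd (c := 1)
      (measurable_outwardNormal k).aestronglyMeasurable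
      (ae_of_all _ fun x => norm_outwardNormal_le_one x k)
  have hface : ∀ (i : Fin 3) (s : ℝ), i ≠ k →
      ∫ y in unitSquare, G (i.insertNth (α := fun _ => ℝ) s y) *
        outwardNormal (i.insertNth (α := fun _ => ℝ) s y) k = 0 := by
    intro i s hik
    -- On the open faces orthogonal to another axis the `k`-th normal component is `0`.
    refine setIntegral_eq_zero_of_forall_eq_zero fun y hy => ?_
    obtain ⟨j, rfl⟩ := Fin.exists_succAbove_eq hik.symm
    have hj := hy j (mem_univ j)
    rw [outwardNormal, Fin.insertNth_apply_succAbove, if_neg hj.2.ne, if_neg hj.1.ne', mul_zero]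
  have hsum : ∀ x, ∑ i, (if i = k then fderiv ℝ G x else 0) (Pi.single i 1) =
      partialDeriv k G x := by
    intro x
    rw [Finset.sum_eq_single k (fun i _ h => by simp [h]) (by simp)]
    simp [partialDeriv]
  have hdiv := integral_divergence_of_hasFDerivAt_off_countable' (n := 2) (0 : Fin 3 → ℝ) 1
    (by intro i; simp) (fun i x => if i = k then G x else 0)
    (fun i x => if i = k then fderiv ℝ G x else 0) ∅ countable_empty
    (fun i => by
      by_cases h : i = k
      · simpa [h] using hG.continuous.continuousOn
      · simpa [h] using continuousOn_const)
    (fun x _ i => by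
      by_cases h : i = k
      · simpa [h] using (hG.differentiable (by norm_num) x).hasFDerivAt
      · simpa [h] using hasFDerivAt_const (0 : ℝ) x)
    (by
      simp only [hsum]
      exact hcont.continuousOn.integrableOn_compact isCompact_Icc)
  rw [integral_surfaceMeasure hint, setIntegral_congr_set unitCube_ae_eq_Icc]
  rw [Finset.sum_eq_single k (fun i _ h => Finset.sum_eq_zero fun s _ => hface i s h) (by simp)]
  rw [Finset.sum_eq_single k (fun i _ h => by simp [h]) (by simp)] at hdiv
  rw [Finset.sum_pair zero_ne_one, setIntegral_congr_set unitSquare_ae_eq_Icc,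
    setIntegral_congr_set unitSquare_ae_eq_Icc]
  simp only [hsum] at hdiv
  rw [hdiv]
  have e0 : ((0 : Fin 3 → ℝ) ∘ k.succAbove) = (0 : Fin 2 → ℝ) := rfl
  have e1 : ((1 : Fin 3 → ℝ) ∘ k.succAbove) = (1 : Fin 2 → ℝ) := rfl
  simp only [outwardNormal, Fin.insertNth_apply_same, if_true, zero_ne_one, if_false, mul_one,
    mul_neg, integral_neg, e0, e1, Pi.zero_apply, Pi.one_apply]
  ring

/-! ### Exponential waves -/

/-- The real exponential wave `x ↦ exp (α · x)`. -/
noncomputable def expWave (α x : Fin 3 → ℝ) : ℝ := Real.exp (∑ i, α i * x i)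

theorem contDiff_expWave (α : Fin 3 → ℝ) : ContDiff ℝ ∞ (expWave α) := by
  unfold expWave
  fun_prop

theorem partialDeriv_expWave (α : Fin 3 → ℝ) (i : Fin 3) (x : Fin 3 → ℝ) :
    partialDeriv i (expWave α) x = α i * expWave α x := by
  have h1 : HasFDerivAt (fun x : Fin 3 → ℝ => ∑ i, α i * x i)
      (∑ i, α i • ContinuousLinearMap.proj (R := ℝ) (φ := fun _ : Fin 3 => ℝ) i) x := by
    refine HasFDerivAt.fun_sum fun i _ => ?_
    exact (ContinuousLinearMap.hasFDerivAt
      (ContinuousLinearMap.proj (R := ℝ) (φ := fun _ : Fin 3 => ℝ) i)).const_mul (α i)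
  have h2 : HasFDerivAt (expWave α) _ x := h1.exp
  rw [partialDeriv, h2.fderiv]
  simp [expWave, Pi.single_apply]
  ring

/-- The functional `v ↦ ∫_Ω v(x) exp (α · x) dx` on `L²(Ω)`. -/
noncomputable def laplaceFunctional (α : Fin 3 → ℝ) : L2 →L[ℝ] ℝ :=
  innerSL ℝ ((memLp_unitCube_of_continuous (contDiff_expWave α).continuous 2).toLp (expWave α))

theorem laplaceFunctional_apply (α : Fin 3 → ℝ) (v : L2) :
    laplaceFunctional α v = ∫ x in unitCube, v x * expWave α x := by
  rw [laplaceFunctional, innerSL_apply_apply, L2.inner_def]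
  refine integral_congr_ae ?_
  filter_upwards [MemLp.coeFn_toLp
    (memLp_unitCube_of_continuous (contDiff_expWave α).continuous 2)] with x hx
  rw [hx]
  simp

theorem integrable_L2 (v : L2) : Integrable v (volume.restrict unitCube) :=
  (Lp.memLp v).integrable (by norm_num)

theorem expWave_le {α x : Fin 3 → ℝ} (hα : 0 ≤ α) (hx : x ∈ Icc (0 : Fin 3 → ℝ) 1) :
    expWave α x ≤ Real.exp (∑ i, α i) :=
  Real.exp_le_exp.2 (Finset.sum_le_sum fun i _ => mul_le_of_le_one_right (hα i) (hx.2 i))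

theorem abs_laplaceFunctional_le {α : Fin 3 → ℝ} (hα : 0 ≤ α) (v : L2) :
    |laplaceFunctional α v| ≤ Real.exp (∑ i, α i) * ∫ x in unitCube, |v x| := by
  rw [laplaceFunctional_apply, ← integral_const_mul, ← Real.norm_eq_abs]
  refine norm_integral_le_of_norm_le ((integrable_L2 v).abs.const_mul _) ?_
  filter_upwards [ae_mem_Icc_unitCube] with x hx
  rw [norm_mul, Real.norm_eq_abs, Real.norm_eq_abs, mul_comm,
    abs_of_pos (show 0 < expWave α x from Real.exp_pos _)]
  exact mul_le_mul_of_nonneg_right (expWave_le hα hx) (abs_nonneg _)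

/-! ### Integration by parts against exponential waves -/

theorem tendsto_integral_mul_of_tendsto_eLpNorm {ν : Measure (Fin 3 → ℝ)} [IsFiniteMeasure ν]
    {w : ℕ → (Fin 3 → ℝ) → ℝ} {v e : (Fin 3 → ℝ) → ℝ} {K : ℝ} (hw : ∀ n, MemLp (w n) 2 ν)
    (hv : MemLp v 2 ν) (he : AEStronglyMeasurable e ν) (heK : ∀ᵐ x ∂ν, ‖e x‖ ≤ K)
    (h : Tendsto (fun n => eLpNorm (fun x => w n x - v x) 2 ν) atTop (𝓝 0)) :
    Tendsto (fun n => ∫ x, w n x * e x ∂ν) atTop (𝓝 (∫ x, v x * e x ∂ν)) := by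
  have i1 : ∀ u : (Fin 3 → ℝ) → ℝ, MemLp u 2 ν → Integrable (fun x => u x * e x) ν := fun u hu =>
    (hu.integrable (by norm_num)).mul_bdd he heK
  refine tendsto_integral_of_L1' _ (i1 v hv).aestronglyMeasurable
    (Eventually.of_forall fun n => i1 _ (hw n)) ?_
  have hlim : Tendsto (fun n => ENNReal.ofReal K *
      (eLpNorm (fun x => w n x - v x) 2 ν * ν univ ^ (1 / (1 : ℝ≥0∞).toReal - 1 / (2 : ℝ≥0∞).toReal)))
      atTop (𝓝 0) := by
    have h2 := ENNReal.Tendsto.mul_const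
      (b := ν univ ^ (1 / (1 : ℝ≥0∞).toReal - 1 / (2 : ℝ≥0∞).toReal)) h
      (Or.inr (ENNReal.rpow_ne_top_of_nonneg (by norm_num) (measure_ne_top _ _)))
    rw [zero_mul] at h2
    simpa using ENNReal.Tendsto.const_mul (a := ENNReal.ofReal K) h2 (Or.inr ENNReal.ofReal_ne_top)
  refine tendsto_of_tendsto_of_tendsto_of_le_of_le tendsto_const_nhds hlim (fun _ => zero_le)
    fun n => ?_
  refine (eLpNorm_le_mul_eLpNorm_of_ae_le_mul (g := fun x => w n x - v x) (c := K) ?_ 1).trans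
    (mul_le_mul_right (eLpNorm_le_eLpNorm_mul_rpow_measure_univ (by norm_num)
      ((hw n).sub hv).aestronglyMeasurable) _)
  filter_upwards [heK] with x hx
  simp only [Pi.sub_apply, ← sub_mul, norm_mul]
  rw [mul_comm]
  exact mul_le_mul_of_nonneg_right hx (norm_nonneg _)

theorem continuous_partialDeriv {i : Fin 3} {ψ : (Fin 3 → ℝ) → ℝ} (h : ContDiff ℝ 1 ψ) :
    Continuous (partialDeriv i ψ) :=
  (h.continuous_fderiv (by norm_num)).clm_apply continuous_const

theorem exists_bound_expWave (α : Fin 3 → ℝ) :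
    ∃ K, ∀ x ∈ Icc (0 : Fin 3 → ℝ) 1, ‖expWave α x‖ ≤ K :=
  exists_bound_Icc (contDiff_expWave α).continuous

theorem integral_partialDeriv_mul_expWave (α : Fin 3 → ℝ) (k : Fin 3) {w : (Fin 3 → ℝ) → ℝ}
    (hw : ContDiff ℝ ∞ w) :
    ∫ x in unitCube, partialDeriv k w x * expWave α x =
      ∫ x, w x * (outwardNormal x k * expWave α x) ∂surfaceMeasure -
        α k * ∫ x in unitCube, w x * expWave α x := by
  have hE := contDiff_expWave α
  have h1 : ContDiff ℝ 1 w := hw.of_le (by exact_mod_cast le_top)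
  have h2 : ContDiff ℝ 1 (expWave α) := hE.of_le (by exact_mod_cast le_top)
  have hprod : ∀ x, partialDeriv k (fun x => w x * expWave α x) x =
      partialDeriv k w x * expWave α x + α k * (w x * expWave α x) := by
    intro x
    have e := partialDeriv_expWave α k x
    unfold partialDeriv at e ⊢
    rw [fderiv_fun_mul (h1.differentiable (by norm_num) x) (h2.differentiable (by norm_num) x)]
    simp only [add_apply, smul_apply, smul_eq_mul, e]
    ring
  have key := integral_partialDeriv_unitCube k (h1.mul h2)
  simp only [hprod] at key
  rw [integral_add, integral_const_mul] at key
  · rw [eq_sub_iff_add_eq, key]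
    exact integral_congr_ae (ae_of_all _ fun x => by ring)
  · exact (memLp_unitCube_of_continuous
      ((continuous_partialDeriv h1).mul h2.continuous) 1).integrable le_rfl
  · exact ((memLp_unitCube_of_continuous
      (h1.continuous.mul h2.continuous) 1).integrable le_rfl).const_mul _

theorem aestronglyMeasurable_normal_mul_expWave (α : Fin 3 → ℝ) (k : Fin 3) :
    AEStronglyMeasurable (fun x => outwardNormal x k * expWave α x) surfaceMeasure :=
  ((measurable_outwardNormal k).mul (contDiff_expWave α).continuous.measurable).aestronglyMeasurable

theorem exists_bound_normal_mul_expWave (α : Fin 3 → ℝ) (k : Fin 3) :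
    ∃ K, ∀ᵐ x ∂surfaceMeasure, ‖outwardNormal x k * expWave α x‖ ≤ K := by
  obtain ⟨K, hK⟩ := exists_bound_expWave α
  refine ⟨K, ?_⟩
  filter_upwards [ae_mem_Icc_surfaceMeasure] with x hx
  rw [norm_mul]
  exact (mul_le_of_le_one_left (norm_nonneg _) (norm_outwardNormal_le_one x k)).trans (hK x hx)

/-- Green's formula for a function with a trace, tested against an exponential wave. -/
theorem HasTrace.laplaceFunctional_weakPartial {v : L2} {γ : Lp ℝ 2 surfaceMeasure}
    (h : HasTrace v γ) (α : Fin 3 → ℝ) (k : Fin 3) :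
    laplaceFunctional α (weakPartial k v) =
      ∫ x, γ x * (outwardNormal x k * expWave α x) ∂surfaceMeasure -
        α k * laplaceFunctional α v := by
  obtain ⟨-, w, hw, hw0, hw1, hwγ⟩ := h
  have hE := (contDiff_expWave α).continuous.aestronglyMeasurable (μ := volume.restrict unitCube)
  obtain ⟨K, hK⟩ := exists_bound_expWave α
  obtain ⟨K', hK'⟩ := exists_bound_normal_mul_expWave α k
  have hEK : ∀ᵐ x ∂volume.restrict unitCube, ‖expWave α x‖ ≤ K := ae_mem_Icc_unitCube.mono hK
  have l0 := tendsto_integral_mul_of_tendsto_eLpNorm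
    (fun n => memLp_unitCube_of_continuous (hw n).continuous 2) (Lp.memLp v) hE hEK hw0
  have l1 := tendsto_integral_mul_of_tendsto_eLpNorm
    (fun n => memLp_unitCube_of_continuous
      (continuous_partialDeriv (i := k) ((hw n).of_le (by exact_mod_cast le_top))) 2)
    (Lp.memLp (weakPartial k v)) hE hEK (hw1 k)
  have l2 := tendsto_integral_mul_of_tendsto_eLpNorm
    (fun n => memLp_surfaceMeasure_of_continuous (hw n).continuous 2) (Lp.memLp γ)
    (aestronglyMeasurable_normal_mul_expWave α k) hK' hwγ
  simp only [integral_partialDeriv_mul_expWave α k (hw _)] at l1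
  rw [laplaceFunctional_apply, laplaceFunctional_apply]
  exact tendsto_nhds_unique l1 (l2.sub (l0.const_mul (α k)))

theorem laplaceFunctional_weakPartial_of_zero_trace {v : L2} (h : HasTrace v 0)
    (α : Fin 3 → ℝ) (k : Fin 3) :
    laplaceFunctional α (weakPartial k v) = -(α k * laplaceFunctional α v) := by
  rw [h.laplaceFunctional_weakPartial α k]
  have : ∫ x, (0 : Lp ℝ 2 surfaceMeasure) x * (outwardNormal x k * expWave α x) ∂surfaceMeasure
      = 0 := by
    refine integral_eq_zero_of_ae ?_
    filter_upwards [Lp.coeFn_zero ℝ 2 surfaceMeasure] with x hx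
    rw [hx]
    simp
  rw [this, zero_sub]

/-! ### Algebra of weak derivatives -/

theorem MemH1.hasWeakPartial {v : L2} (h : MemH1 v) (i : Fin 3) :
    HasWeakPartial i v (weakPartial i v) := by
  obtain ⟨w, hw⟩ := h i
  rwa [hw.weakPartial_eq]

theorem integrable_mul_test (v : L2) {ψ : (Fin 3 → ℝ) → ℝ} (hψ : Continuous ψ) :
    Integrable (fun x => v x * ψ x) (volume.restrict unitCube) := by
  obtain ⟨C, hC⟩ := exists_bound_Icc hψ
  exact (integrable_L2 v).mul_bdd hψ.aestronglyMeasurable (ae_mem_Icc_unitCube.mono hC)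

theorem integral_add_mul_test (v v' : L2) {ψ : (Fin 3 → ℝ) → ℝ} (hψ : Continuous ψ) :
    ∫ x in unitCube, (v + v') x * ψ x =
      (∫ x in unitCube, v x * ψ x) + ∫ x in unitCube, v' x * ψ x := by
  rw [← integral_add (integrable_mul_test v hψ) (integrable_mul_test v' hψ)]
  refine integral_congr_ae ?_
  filter_upwards [Lp.coeFn_add v v'] with x hx
  rw [hx, Pi.add_apply, add_mul]

theorem integral_smul_mul_test (c : ℝ) (v : L2) (ψ : (Fin 3 → ℝ) → ℝ) :
    ∫ x in unitCube, (c • v) x * ψ x = c * ∫ x in unitCube, v x * ψ x := by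
  rw [← integral_const_mul]
  refine integral_congr_ae ?_
  filter_upwards [Lp.coeFn_smul c v] with x hx
  rw [hx, Pi.smul_apply, smul_eq_mul, mul_assoc]

theorem HasWeakPartial.add {i : Fin 3} {v w v' w' : L2} (h : HasWeakPartial i v w)
    (h' : HasWeakPartial i v' w') : HasWeakPartial i (v + v') (w + w') := by
  intro ψ h1 h2 h3
  have h4 : ContDiff ℝ 1 ψ := h1.of_le (by exact_mod_cast le_top)
  rw [integral_add_mul_test _ _ (continuous_partialDeriv h4),
    integral_add_mul_test _ _ h1.continuous, h ψ h1 h2 h3, h' ψ h1 h2 h3, neg_add]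

theorem HasWeakPartial.smul {i : Fin 3} {v w : L2} (c : ℝ) (h : HasWeakPartial i v w) :
    HasWeakPartial i (c • v) (c • w) := by
  intro ψ h1 h2 h3
  rw [integral_smul_mul_test, integral_smul_mul_test, h ψ h1 h2 h3, mul_neg]

theorem contDiff_partialDeriv {i : Fin 3} {ψ : (Fin 3 → ℝ) → ℝ} (h : ContDiff ℝ ∞ ψ) :
    ContDiff ℝ ∞ (partialDeriv i ψ) := by
  unfold partialDeriv
  exact (h.fderiv_right (m := ∞) (by simp)).clm_apply contDiff_const

theorem tsupport_partialDeriv_subset (i : Fin 3) (ψ : (Fin 3 → ℝ) → ℝ) :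
    tsupport (partialDeriv i ψ) ⊆ tsupport ψ := by
  refine closure_minimal (fun x hx => ?_) isClosed_closure
  refine support_fderiv_subset ℝ (f := ψ) fun h => hx ?_
  simp [partialDeriv, h]

theorem partialDeriv_comm (i j : Fin 3) {ψ : (Fin 3 → ℝ) → ℝ} (h : ContDiff ℝ ∞ ψ)
    (x : Fin 3 → ℝ) :
    partialDeriv i (partialDeriv j ψ) x = partialDeriv j (partialDeriv i ψ) x := by
  have hd : DifferentiableAt ℝ (fderiv ℝ ψ) x :=
    ((contDiff_infty_iff_fderiv.1 h).2).differentiable (by simp) x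
  have e : ∀ i j : Fin 3, partialDeriv i (partialDeriv j ψ) x =
      fderiv ℝ (fderiv ℝ ψ) x (Pi.single i 1) (Pi.single j 1) := by
    intro i j
    have : HasFDerivAt (partialDeriv j ψ) _ x :=
      hd.hasFDerivAt.clm_apply (hasFDerivAt_const (Pi.single j 1) x)
    rw [partialDeriv, this.fderiv]
    simp
  rw [e, e]
  exact (h.contDiffAt.isSymmSndFDerivAt (by simpa using WithTop.coe_le_coe.2 (le_top : (2 : ℕ∞) ≤ ⊤))) _ _

theorem weakPartial_comm {v : L2} (h : MemH2 v) (i j : Fin 3) :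
    weakPartial i (weakPartial j v) = weakPartial j (weakPartial i v) := by
  have key : ∀ i j : Fin 3, ∀ ψ : (Fin 3 → ℝ) → ℝ, ContDiff ℝ ∞ ψ → HasCompactSupport ψ →
      tsupport ψ ⊆ unitCube → ∫ x in unitCube, weakPartial i (weakPartial j v) x * ψ x =
        ∫ x in unitCube, v x * partialDeriv j (partialDeriv i ψ) x := by
    intro i j ψ h1 h2 h3
    have a := (h.2 j).hasWeakPartial i ψ h1 h2 h3
    have b := h.1.hasWeakPartial j (partialDeriv i ψ) (contDiff_partialDeriv h1)
      (h2.mono' ((subset_tsupport _).trans (tsupport_partialDeriv_subset i ψ)))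
      ((tsupport_partialDeriv_subset i ψ).trans h3)
    linarith
  refine ((h.2 i).hasWeakPartial j).weakPartial_eq.symm ▸ ?_
  refine HasWeakPartial.weakPartial_eq fun ψ h1 h2 h3 => ?_
  rw [(h.2 j).hasWeakPartial i ψ h1 h2 h3, key i j ψ h1 h2 h3, key j i ψ h1 h2 h3]
  simp only [partialDeriv_comm i j h1]

theorem weakPartial_add {v v' : L2} (h : MemH1 v) (h' : MemH1 v') (i : Fin 3) :
    weakPartial i (v + v') = weakPartial i v + weakPartial i v' :=
  ((h.hasWeakPartial i).add (h'.hasWeakPartial i)).weakPartial_eq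

theorem weakPartial_smul {v : L2} (h : MemH1 v) (c : ℝ) (i : Fin 3) :
    weakPartial i (c • v) = c • weakPartial i v :=
  ((h.hasWeakPartial i).smul c).weakPartial_eq

theorem MemH1.add {v v' : L2} (h : MemH1 v) (h' : MemH1 v') : MemH1 (v + v') :=
  fun i => ⟨_, (h.hasWeakPartial i).add (h'.hasWeakPartial i)⟩

theorem MemH1.smul {v : L2} (c : ℝ) (h : MemH1 v) : MemH1 (c • v) :=
  fun i => ⟨_, (h.hasWeakPartial i).smul c⟩

theorem memH1_divergence {v : Fin 3 → L2} (h : ∀ k, MemH2 (v k)) : MemH1 (divergence v) := by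
  rw [divergence, Fin.sum_univ_three]
  exact (((h 0).2 0).add ((h 1).2 1)).add ((h 2).2 2)

theorem weakPartial_divergence {v : Fin 3 → L2} (h : ∀ k, MemH2 (v k)) (j : Fin 3) :
    weakPartial j (divergence v) = ∑ k, weakPartial k (weakPartial j (v k)) := by
  rw [divergence, Fin.sum_univ_three, Fin.sum_univ_three,
    weakPartial_add (((h 0).2 0).add ((h 1).2 1)) ((h 2).2 2),
    weakPartial_add ((h 0).2 0) ((h 1).2 1),
    weakPartial_comm (h 0), weakPartial_comm (h 1), weakPartial_comm (h 2)]

/-- The row-wise divergence of the stress tensor is the Lamé operator. -/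
theorem sum_weakPartial_stress (lam mu : ℝ) {v : Fin 3 → L2} (h : ∀ k, MemH2 (v k)) (j : Fin 3) :
    ∑ k, weakPartial k (stress lam mu v j k) =
      mu • laplacian (v j) + (lam + mu) • weakPartial j (divergence v) := by
  have hs : ∀ k, weakPartial k (stress lam mu v j k) =
      (if k = j then lam • weakPartial j (divergence v) else 0) +
        mu • (weakPartial k (weakPartial k (v j)) + weakPartial k (weakPartial j (v k))) := by
    intro k
    by_cases hk : k = j
    · subst hk
      rw [stress, if_pos rfl, if_pos rfl,
        weakPartial_add ((memH1_divergence h).smul lam) (((h k).2 k).smul _),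
        weakPartial_smul (memH1_divergence h), weakPartial_smul ((h k).2 k)]
      module
    · rw [stress, if_neg (Ne.symm hk), if_neg hk, zero_add,
        weakPartial_smul (((h j).2 k).add ((h k).2 j)), weakPartial_add ((h j).2 k) ((h k).2 j)]
  simp only [hs, Finset.sum_add_distrib, ← Finset.smul_sum, Finset.sum_ite_eq', Finset.mem_univ,
    if_true]
  rw [← weakPartial_divergence h, ← laplacian]
  module

/-! ### The Lamé system tested against polarized exponential waves -/

/-- The functional `v ↦ ∫_Ω (a · v(x)) exp (α · x) dx` on `L²(Ω)³`: testing against the exponential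
wave with wave vector `α` and polarization `a`. -/
noncomputable def waveFunctional (α a : Fin 3 → ℝ) : (Fin 3 → L2) →L[ℝ] ℝ :=
  ∑ j, a j • (laplaceFunctional α).comp (ContinuousLinearMap.proj j)

theorem waveFunctional_apply (α a : Fin 3 → ℝ) (v : Fin 3 → L2) :
    waveFunctional α a v = ∑ j, a j * laplaceFunctional α (v j) := by
  simp [waveFunctional]

theorem abs_waveFunctional_le {α : Fin 3 → ℝ} (hα : 0 ≤ α) (a : Fin 3 → ℝ) (v : Fin 3 → L2) :
    |waveFunctional α a v| ≤
      Real.exp (∑ i, α i) * ∑ j, |a j| * ∫ x in unitCube, |v j x| := by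
  rw [waveFunctional_apply, Finset.mul_sum]
  refine (Finset.abs_sum_le_sum_abs _ _).trans (Finset.sum_le_sum fun j _ => ?_)
  rw [abs_mul, mul_left_comm]
  exact mul_le_mul_of_nonneg_left (abs_laplaceFunctional_le hα (v j)) (abs_nonneg _)

/-- The wave `a exp (α · x)` is an eigenfunction of the Lamé operator with eigenvalue `κ |α|²`,
written as an identity of linear forms in `V`. Here `√κ` is the speed of the mode: `κ = lam + 2 mu`
if `a` is parallel to `α`, and `κ = mu` if `a` is orthogonal to `α`. -/
def IsLameMode (lam mu κ : ℝ) (α a : Fin 3 → ℝ) : Prop :=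
  ∀ V : Fin 3 → ℝ, mu * (∑ i, α i ^ 2) * (∑ j, a j * V j) +
    (lam + mu) * (∑ j, a j * α j) * (∑ j, α j * V j) = κ * (∑ i, α i ^ 2) * ∑ j, a j * V j

theorem isLameMode_longitudinal (lam mu : ℝ) (α : Fin 3 → ℝ) :
    IsLameMode lam mu (lam + 2 * mu) α α := by
  intro V
  simp only [← pow_two]
  ring

theorem isLameMode_transverse (lam mu : ℝ) {α a : Fin 3 → ℝ} (h : ∑ j, a j * α j = 0) :
    IsLameMode lam mu mu α a := by
  intro V
  rw [h]
  ring

theorem IsLameMode.smul {lam mu κ : ℝ} {α a : Fin 3 → ℝ} (h : IsLameMode lam mu κ α a) (s : ℝ) :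
    IsLameMode lam mu κ (s • α) a := by
  intro V
  have := h V
  simp only [Fin.sum_univ_three, Pi.smul_apply, smul_eq_mul] at this ⊢
  linear_combination s ^ 2 * this

/-- For a clamped displacement, the stress tensor tested against an exponential wave involves no
boundary term. -/
theorem laplaceFunctional_stress (lam mu : ℝ) {v : Fin 3 → L2} (h0 : ∀ k, HasTrace (v k) 0)
    (α : Fin 3 → ℝ) (j k : Fin 3) :
    laplaceFunctional α (stress lam mu v j k) =
      -((if k = j then lam * ∑ i, α i * laplaceFunctional α (v i) else 0) +
        mu * (α k * laplaceFunctional α (v j) + α j * laplaceFunctional α (v k))) := by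
  have e := fun i k => laplaceFunctional_weakPartial_of_zero_trace (h0 i) α k
  by_cases hjk : j = k
  · subst hjk
    simp only [stress, if_true, divergence, map_add, map_smul, map_sum, e, smul_eq_mul,
      Finset.sum_neg_distrib]
    ring
  · simp only [stress, if_neg hjk, if_neg (Ne.symm hjk), map_add, map_smul, e, smul_eq_mul]
    ring

/-- Betti's formula: tested against a mode, the Lamé operator becomes multiplication by `κ |α|²`,
up to a term that depends on the surface stress only. -/
theorem waveFunctional_lame {lam mu κ : ℝ} {α a : Fin 3 → ℝ} (hmode : IsLameMode lam mu κ α a)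
    {v : Fin 3 → L2} (h2 : ∀ k, MemH2 (v k)) (h0 : ∀ k, HasTrace (v k) 0)
    {τ : Fin 3 → Fin 3 → Lp ℝ 2 surfaceMeasure}
    (hτ : ∀ j k, HasTrace (stress lam mu v j k) (τ j k)) {Y : Fin 3 → (Fin 3 → ℝ) → ℝ}
    (hY : ∀ j, ∀ᵐ x ∂surfaceMeasure, ∑ k, τ j k x * outwardNormal x k = Y j x) :
    waveFunctional α a (fun j => mu • laplacian (v j) + (lam + mu) • weakPartial j (divergence v)) =
      (∑ j, a j * ∫ x, Y j x * expWave α x ∂surfaceMeasure) +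
        κ * (∑ i, α i ^ 2) * waveFunctional α a v := by
  have hbdry : ∀ j, ∑ k, ∫ x, τ j k x * (outwardNormal x k * expWave α x) ∂surfaceMeasure =
      ∫ x, Y j x * expWave α x ∂surfaceMeasure := by
    intro j
    rw [← integral_finsetSum]
    · refine integral_congr_ae ?_
      filter_upwards [hY j] with x hx
      rw [← hx, Finset.sum_mul]
      exact Finset.sum_congr rfl fun k _ => by ring
    · intro k _
      obtain ⟨K, hK⟩ := exists_bound_normal_mul_expWave α k
      exact ((Lp.memLp (τ j k)).integrable (by norm_num)).mul_bdd
        (aestronglyMeasurable_normal_mul_expWave α k) hK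
  have hrow : ∀ j, laplaceFunctional α
      (mu • laplacian (v j) + (lam + mu) • weakPartial j (divergence v)) =
      (∫ x, Y j x * expWave α x ∂surfaceMeasure) +
        (mu * (∑ i, α i ^ 2) * laplaceFunctional α (v j) +
          (lam + mu) * α j * ∑ i, α i * laplaceFunctional α (v i)) := by
    intro j
    rw [← sum_weakPartial_stress lam mu h2 j, map_sum, ← hbdry j]
    simp only [(hτ j _).laplaceFunctional_weakPartial, laplaceFunctional_stress lam mu h0,
      sub_eq_add_neg, mul_neg, neg_neg, mul_add, Finset.sum_add_distrib, mul_ite, mul_zero,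
      Finset.sum_ite_eq', Finset.mem_univ, if_true]
    simp only [Fin.sum_univ_three]
    ring
  rw [waveFunctional_apply, waveFunctional_apply, ← hmode]
  simp only [hrow]
  simp only [Fin.sum_univ_three]
  ring

/-- Each mode of a solution satisfies a scalar equation whose boundary term is determined by the
data `X`. -/
theorem IsSolution.waveFunctional_equation {lam mu T : ℝ} {φ : ℝ → ℝ}
    {X : ℝ → Fin 3 → Lp ℝ 1 surfaceMeasure} {g h : Fin 3 → L2} {u : ℝ → Fin 3 → L2}
    {f : Fin 3 → L2} (hsol : IsSolution lam mu T φ X g h u f) {κ : ℝ} {α a : Fin 3 → ℝ}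
    (hmode : IsLameMode lam mu κ α a) :
    ∀ᵐ t ∂volume.restrict (Ioo 0 T),
      waveFunctional α a (iteratedDerivWithin 2 u (Icc 0 T) t) -
        κ * (∑ i, α i ^ 2) * waveFunctional α a (u t) =
      φ t * waveFunctional α a f +
        ∑ j, a j * ∫ x, X t j x * expWave α x ∂surfaceMeasure := by
  have h2 : ∀ᵐ t ∂volume.restrict (Ioo 0 T), ∀ k, MemH2 (u t k) :=
    ae_all_iff.2 fun k => (hsol.memL2H2 k).memH2
  filter_upwards [h2, hsol.equation, hsol.clamped, hsol.surface_stress] with t h2 heq h0 hX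
  obtain ⟨τ, hτ, hY⟩ := hX
  have hvec : iteratedDerivWithin 2 u (Icc 0 T) t = φ t • f +
      fun j => mu • laplacian (u t j) + (lam + mu) • weakPartial j (divergence (u t)) := by
    funext k
    rw [Pi.add_apply, Pi.smul_apply, ← heq k]
    abel
  rw [hvec, map_add, map_smul, waveFunctional_lame hmode h2 h0 hτ hY, smul_eq_mul]
  ring

/-! ### The scalar equation for a single mode -/

theorem hasDerivWithinAt_of_contDiffOn_two {E : Type*} [NormedAddCommGroup E] [NormedSpace ℝ E]
    {T : ℝ} (hT : 0 < T) {u : ℝ → E} (hu : ContDiffOn ℝ 2 u (Icc 0 T)) :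
    (∀ t ∈ Icc 0 T, HasDerivWithinAt u (derivWithin u (Icc 0 T) t) (Icc 0 T) t) ∧
    (∀ t ∈ Icc 0 T, HasDerivWithinAt (derivWithin u (Icc 0 T))
      (iteratedDerivWithin 2 u (Icc 0 T) t) (Icc 0 T) t) ∧
    ContinuousOn (iteratedDerivWithin 2 u (Icc 0 T)) (Icc 0 T) := by
  have hud := uniqueDiffOn_Icc hT
  have h1 : iteratedDerivWithin 1 u (Icc 0 T) = derivWithin u (Icc 0 T) :=
    iteratedDerivWithin_one
  refine ⟨fun t ht => (hu.differentiableOn (by norm_num) t ht).hasDerivWithinAt, fun t ht => ?_,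
    hu.continuousOn_iteratedDerivWithin le_rfl hud⟩
  rw [iteratedDerivWithin_succ, h1]
  have := hu.differentiableOn_iteratedDerivWithin (m := 1) (by norm_num) hud
  rw [h1] at this
  exact (this t ht).hasDerivWithinAt

/-- Duhamel's formula for the growing half of `W'' = c² W + Φ φ`: the combination `W' + c W`
solves a first order equation. -/
theorem exp_mul_eq_integral_of_ode {T c Φ : ℝ} {φ W W₁ W₂ : ℝ → ℝ}
    (h1 : ∀ t ∈ Icc 0 T, HasDerivWithinAt W (W₁ t) (Icc 0 T) t)
    (h2 : ∀ t ∈ Icc 0 T, HasDerivWithinAt W₁ (W₂ t) (Icc 0 T) t)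
    (hcont : ContinuousOn W₂ (Icc 0 T))
    (hode : ∀ᵐ t ∂volume.restrict (Ioo 0 T), W₂ t - c ^ 2 * W t = φ t * Φ)
    (hW : W 0 = 0) (hW₁ : W₁ 0 = 0) {t : ℝ} (ht : t ∈ Icc 0 T) :
    (W₁ t + c * W t) * Real.exp (-c * t) = Φ * ∫ s in 0..t, φ s * Real.exp (-c * s) := by
  have hsub : Icc 0 t ⊆ Icc 0 T := Icc_subset_Icc_right ht.2
  have hWc : ContinuousOn W (Icc 0 T) := fun s hs => (h1 s hs).continuousWithinAt
  have hW₁c : ContinuousOn W₁ (Icc 0 T) := fun s hs => (h2 s hs).continuousWithinAt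
  have hexp : Continuous fun s : ℝ => Real.exp (-c * s) := by fun_prop
  have hFTC := intervalIntegral.integral_eq_sub_of_hasDerivAt_of_le ht.1
    (f := fun s => (W₁ s + c * W s) * Real.exp (-c * s))
    (f' := fun s => (W₂ s - c ^ 2 * W s) * Real.exp (-c * s))
    (((hW₁c.add (hWc.const_smul c)).mul hexp.continuousOn).mono hsub)
    (fun s hs => by
      have hs' : s ∈ Icc 0 T := hsub (Ioo_subset_Icc_self hs)
      have hnhds : Icc 0 T ∈ 𝓝 s := Icc_mem_nhds hs.1 (hs.2.trans_le ht.2)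
      have d1 := (h1 s hs').hasDerivAt hnhds
      have d2 := (h2 s hs').hasDerivAt hnhds
      have d3 : HasDerivAt (fun s : ℝ => Real.exp (-c * s)) (Real.exp (-c * s) * (-c * 1)) s :=
        ((hasDerivAt_id s).const_mul (-c)).exp
      exact ((d2.add (d1.const_mul c)).mul d3).congr_deriv (by simp only [Pi.add_apply]; ring))
    (((hcont.sub (hWc.const_smul (c ^ 2))).mul hexp.continuousOn).mono
      (by rw [uIcc_of_le ht.1]; exact hsub)).intervalIntegrable
  simp only [hW, hW₁, mul_zero, add_zero, zero_mul, sub_zero] at hFTC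
  rw [← hFTC, ← intervalIntegral.integral_const_mul, intervalIntegral.integral_of_le ht.1,
    intervalIntegral.integral_of_le ht.1, integral_Ioc_eq_integral_Ioo, integral_Ioc_eq_integral_Ioo]
  refine integral_congr_ae ?_
  filter_upwards [ae_restrict_of_ae_restrict_of_subset (Ioo_subset_Ioo_right ht.2) hode] with s hs
  rw [hs]
  ring

theorem eq_zero_of_deriv_add_mul_eq_zero {T c : ℝ} {W W₁ : ℝ → ℝ}
    (h1 : ∀ t ∈ Icc 0 T, HasDerivWithinAt W (W₁ t) (Icc 0 T) t)
    (h : ∀ t ∈ Icc 0 T, W₁ t + c * W t = 0) (hW : W 0 = 0) {t : ℝ} (ht : t ∈ Icc 0 T) :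
    W t = 0 := by
  have hsub : Icc 0 t ⊆ Icc 0 T := Icc_subset_Icc_right ht.2
  have hWc : ContinuousOn W (Icc 0 T) := fun s hs => (h1 s hs).continuousWithinAt
  have hexp : Continuous fun s : ℝ => Real.exp (c * s) := by fun_prop
  have hFTC := intervalIntegral.integral_eq_sub_of_hasDerivAt_of_le ht.1
    (f := fun s => W s * Real.exp (c * s)) (f' := fun _ => 0)
    ((hWc.mul hexp.continuousOn).mono hsub)
    (fun s hs => by
      have hs' : s ∈ Icc 0 T := hsub (Ioo_subset_Icc_self hs)
      have d1 := (h1 s hs').hasDerivAt (Icc_mem_nhds hs.1 (hs.2.trans_le ht.2))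
      have d3 : HasDerivAt (fun s : ℝ => Real.exp (c * s)) (Real.exp (c * s) * (c * 1)) s :=
        ((hasDerivAt_id s).const_mul c).exp
      exact (d1.mul d3).congr_deriv (by linear_combination Real.exp (c * s) * h s hs'))
    intervalIntegrable_const
  simp only [hW, zero_mul, sub_zero, intervalIntegral.integral_zero] at hFTC
  exact (mul_eq_zero.1 hFTC.symm).resolve_right (Real.exp_pos _).ne'

/-- The Laplace transform of `φ` over `(0, T)` decays no faster than `1 / s`: the part over `(0, Λ)`
contributes at least `C (1 - exp (-s Λ)) / s`, the rest is exponentially small. -/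
theorem half_le_mul_integral_exp {T Λ C : ℝ} {φ : ℝ → ℝ} (hφ : IntegrableOn φ (Ioo 0 T))
    (hΛ : Λ ∈ Ioo 0 T) (hC : 0 < C) (h : ∀ᵐ t ∂volume.restrict (Ioo 0 Λ), C ≤ φ t) :
    ∀ᶠ s : ℝ in atTop, C / 2 ≤ s * ∫ t in 0..T, φ t * Real.exp (-s * t) := by
  have hT : 0 < T := hΛ.1.trans hΛ.2
  set M := ∫ t in Λ..T, |φ t|
  have hint : ∀ a b, 0 ≤ a → a ≤ b → b ≤ T → IntervalIntegrable φ volume a b := by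
    intro a b h0 hab hb
    rw [intervalIntegrable_iff_integrableOn_Ioo_of_le hab]
    exact hφ.mono_set (Ioo_subset_Ioo h0 hb)
  have hinte : ∀ s a b, 0 ≤ a → a ≤ b → b ≤ T →
      IntervalIntegrable (fun t => φ t * Real.exp (-s * t)) volume a b := fun s a b h0 hab hb =>
    (hint a b h0 hab hb).mul_continuousOn (by fun_prop)
  have key : ∀ s > 0, C - (C + s * M) * Real.exp (-s * Λ) ≤
      s * ∫ t in 0..T, φ t * Real.exp (-s * t) := by
    intro s hs
    rw [← intervalIntegral.integral_add_adjacent_intervals (hinte s 0 Λ le_rfl hΛ.1.le hΛ.2.le)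
      (hinte s Λ T hΛ.1.le hΛ.2.le le_rfl)]
    have b1 : ∫ t in 0..Λ, C * Real.exp (-s * t) ≤ ∫ t in 0..Λ, φ t * Real.exp (-s * t) := by
      rw [intervalIntegral.integral_of_le hΛ.1.le, intervalIntegral.integral_of_le hΛ.1.le,
        integral_Ioc_eq_integral_Ioo, integral_Ioc_eq_integral_Ioo]
      refine integral_mono_ae ?_ ?_ ?_
      · exact (intervalIntegrable_iff_integrableOn_Ioo_of_le hΛ.1.le enorm_ne_top enorm_ne_top).1
          (Continuous.intervalIntegrable (by fun_prop) 0 Λ)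
      · exact (intervalIntegrable_iff_integrableOn_Ioo_of_le hΛ.1.le enorm_ne_top enorm_ne_top).1
          (hinte s 0 Λ le_rfl hΛ.1.le hΛ.2.le)
      · filter_upwards [h] with t ht
        exact mul_le_mul_of_nonneg_right ht (Real.exp_pos _).le
    have b2 : ∫ t in 0..Λ, C * Real.exp (-s * t) = C * (1 - Real.exp (-s * Λ)) / s := by
      have hF : ∀ t ∈ uIcc 0 Λ, HasDerivAt (fun t : ℝ => -C / s * Real.exp (-s * t))
          (C * Real.exp (-s * t)) t := by
        intro t _
        have d3 : HasDerivAt (fun t : ℝ => Real.exp (-s * t)) (Real.exp (-s * t) * (-s * 1)) t :=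
          ((hasDerivAt_id t).const_mul (-s)).exp
        exact (d3.const_mul (-C / s)).congr_deriv (by field_simp)
      rw [intervalIntegral.integral_eq_sub_of_hasDerivAt hF
        (Continuous.intervalIntegrable (by fun_prop) 0 Λ), mul_zero, Real.exp_zero]
      ring
    have b3 : |∫ t in Λ..T, φ t * Real.exp (-s * t)| ≤ Real.exp (-s * Λ) * M := by
      rw [← intervalIntegral.integral_const_mul, ← Real.norm_eq_abs]
      refine intervalIntegral.norm_integral_le_of_norm_le hΛ.2.le (ae_of_all _ fun t ht => ?_)
        ((hint Λ T hΛ.1.le hΛ.2.le le_rfl).abs.const_mul _)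
      rw [norm_mul, Real.norm_eq_abs, Real.norm_eq_abs, mul_comm, Real.abs_exp]
      refine mul_le_mul_of_nonneg_right (Real.exp_le_exp.2 ?_) (abs_nonneg _)
      nlinarith [ht.1]
    have b4 := (abs_le.1 b3).1
    have b5 : C * (1 - Real.exp (-s * Λ)) / s - Real.exp (-s * Λ) * M ≤
        (∫ t in 0..Λ, φ t * Real.exp (-s * t)) + ∫ t in Λ..T, φ t * Real.exp (-s * t) := by
      linarith
    refine le_trans (le_of_eq ?_) (mul_le_mul_of_nonneg_left b5 hs.le)
    field_simp
    ring
  have hlim : Tendsto (fun s : ℝ => C - (C + s * M) * Real.exp (-s * Λ)) atTop (𝓝 C) := by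
    have l0 := Real.tendsto_pow_mul_exp_neg_atTop_nhds_zero 0
    have l1 := Real.tendsto_pow_mul_exp_neg_atTop_nhds_zero 1
    have lΛ : Tendsto (fun s : ℝ => s * Λ) atTop atTop := tendsto_id.atTop_mul_const hΛ.1
    have := tendsto_const_nhds (x := C) |>.sub
      (((l0.comp lΛ).const_mul C).add ((l1.comp lΛ).const_mul (M / Λ)))
    simp only [mul_zero, add_zero, sub_zero] at this
    refine this.congr fun s => ?_
    have := hΛ.1.ne'
    simp only [Function.comp, pow_zero, pow_one, neg_mul]
    field_simp
  filter_upwards [hlim.eventually (lt_mem_nhds (half_lt_self hC)), eventually_gt_atTop 0]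
    with s hs h0 using hs.le.trans (key s h0)

theorem exists_le_mul_abs_integral_exp {T : ℝ} {φ : ℝ → ℝ} (hφ : IntegrableOn φ (Ioo 0 T))
    (hW1 : ∃ Λ ∈ Ioo 0 T, ∃ C > 0,
      (∀ᵐ t ∂volume.restrict (Ioo 0 Λ), C ≤ φ t) ∨
      (∀ᵐ t ∂volume.restrict (Ioo 0 Λ), φ t ≤ -C)) :
    ∃ K > 0, ∀ᶠ s : ℝ in atTop, K ≤ s * |∫ t in 0..T, φ t * Real.exp (-s * t)| := by
  obtain ⟨Λ, hΛ, C, hC, h | h⟩ := hW1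
  · refine ⟨C / 2, half_pos hC, ?_⟩
    filter_upwards [half_le_mul_integral_exp hφ hΛ hC h, eventually_ge_atTop 0] with s hs h0
    exact hs.trans (mul_le_mul_of_nonneg_left (le_abs_self _) h0)
  · refine ⟨C / 2, half_pos hC, ?_⟩
    filter_upwards [half_le_mul_integral_exp hφ.neg hΛ hC (h.mono fun t ht => by
      simp only [Pi.neg_apply]; linarith), eventually_ge_atTop 0] with s hs h0
    simp only [Pi.neg_apply, neg_mul, intervalIntegral.integral_neg] at hs ⊢
    exact (hs.trans (mul_le_mul_of_nonneg_left (neg_le_abs _) h0))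

/-! ### Exponential moments that decay must vanish -/

section ComplexMoments

variable {S : Type*} [MeasurableSpace S] {ν : Measure S} {F ψ : S → ℝ} {M : ℝ}

theorem norm_exp_complex_le {y : ℝ} (hy0 : 0 ≤ y) (hyM : y ≤ M) (z : ℂ) :
    ‖Complex.exp (z * y)‖ ≤ Real.exp (M * ‖z‖) := by
  rw [Complex.norm_exp, Complex.re_mul_ofReal]
  refine Real.exp_le_exp.2 ?_
  calc z.re * y ≤ ‖z‖ * y := mul_le_mul_of_nonneg_right (Complex.re_le_norm z) hy0
    _ ≤ ‖z‖ * M := mul_le_mul_of_nonneg_left hyM (norm_nonneg _)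
    _ = M * ‖z‖ := mul_comm _ _

theorem differentiable_integral_mul_cexp (hF : Integrable F ν) (hψ : AEMeasurable ψ ν)
    (h0 : ∀ᵐ x ∂ν, 0 ≤ ψ x) (hM : ∀ᵐ x ∂ν, ψ x ≤ M) :
    Differentiable ℂ fun z : ℂ => ∫ x, (F x : ℂ) * Complex.exp (z * ψ x) ∂ν := by
  intro z₀
  have hm : ∀ z : ℂ, AEStronglyMeasurable (fun x => Complex.exp (z * ψ x)) ν := fun z =>
    ((Complex.measurable_ofReal.comp_aemeasurable hψ).const_mul z).cexp.aestronglyMeasurable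
  refine ((hasDerivAt_integral_of_dominated_loc_of_deriv_le
    (bound := fun x => |F x| * (M * Real.exp (M * (‖z₀‖ + 1))))
    (F' := fun z x => (F x : ℂ) * (Complex.exp (z * ψ x) * ψ x)) (Metric.ball_mem_nhds z₀ one_pos)
    (Eventually.of_forall fun z => hF.ofReal.aestronglyMeasurable.mul (hm z))
    (hF.ofReal.mul_bdd (c := Real.exp (M * ‖z₀‖)) (hm z₀) ?_)
    (hF.ofReal.aestronglyMeasurable.mul ((hm z₀).mul
      (Complex.measurable_ofReal.comp_aemeasurable hψ).aestronglyMeasurable))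
    ?_ (hF.abs.mul_const _) (ae_of_all _ fun x z _ => ?_)).2).differentiableAt
  · filter_upwards [h0, hM] with x hx hx' using norm_exp_complex_le hx hx' z₀
  · filter_upwards [h0, hM] with x hx hx' z hz
    have hz' : ‖z‖ ≤ ‖z₀‖ + 1 := by
      have h3 : ‖z - z₀‖ < 1 := by simpa [dist_eq_norm] using hz
      have := norm_sub_norm_le z z₀
      linarith
    rw [norm_mul, norm_mul, Complex.norm_real, Complex.norm_real, Real.norm_eq_abs,
      Real.norm_eq_abs, abs_of_nonneg hx, mul_comm (‖Complex.exp _‖)]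
    refine mul_le_mul_of_nonneg_left (mul_le_mul hx' ?_ (norm_nonneg _) (hx.trans hx'))
      (abs_nonneg _)
    exact (norm_exp_complex_le hx hx' z).trans
      (Real.exp_le_exp.2 (mul_le_mul_of_nonneg_left hz' (hx.trans hx')))
  · have h1 : HasDerivAt (fun z : ℂ => z * (ψ x : ℂ)) (1 * (ψ x : ℂ)) z :=
      (hasDerivAt_id z).mul_const _
    exact (h1.cexp.const_mul (F x : ℂ)).congr_deriv (by ring)

/-- If `ψ` takes values in `[0, M]` and `∫ F exp (s ψ)` tends to `0` as `s → ∞`, then it vanishes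
for all `s`. The complex extension to `s ∈ ℂ` is entire of exponential type; it is bounded on the
left half-plane because `ψ ≥ 0`, and on the right half-plane by the Phragmén–Lindelöf principle, so
that it is constant by Liouville's theorem. -/
theorem integral_mul_exp_eq_zero_of_tendsto (hF : Integrable F ν) (hψ : AEMeasurable ψ ν)
    (h0 : ∀ᵐ x ∂ν, 0 ≤ ψ x) (hM : ∀ᵐ x ∂ν, ψ x ≤ M)
    (hlim : Tendsto (fun s : ℝ => ∫ x, F x * Real.exp (s * ψ x) ∂ν) atTop (𝓝 0)) (s : ℝ) :
    ∫ x, F x * Real.exp (s * ψ x) ∂ν = 0 := by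
  set H : ℂ → ℂ := fun z => ∫ x, (F x : ℂ) * Complex.exp (z * ψ x) ∂ν with hH
  have hreal : ∀ s : ℝ, H s = ((∫ x, F x * Real.exp (s * ψ x) ∂ν : ℝ) : ℂ) := by
    intro s
    rw [← integral_complex_ofReal]
    simp [hH]
  have hd : Differentiable ℂ H := differentiable_integral_mul_cexp hF hψ h0 hM
  set N := ∫ x, |F x| ∂ν
  have hgen : ∀ (z : ℂ) (B : ℝ), (∀ᵐ x ∂ν, ‖Complex.exp (z * ψ x)‖ ≤ B) → ‖H z‖ ≤ N * B := by
    intro z B hB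
    rw [← integral_mul_const]
    refine norm_integral_le_of_norm_le (hF.abs.mul_const B) ?_
    filter_upwards [hB] with x hx
    rw [norm_mul, Complex.norm_real, Real.norm_eq_abs]
    exact mul_le_mul_of_nonneg_left hx (abs_nonneg _)
  have hleft : ∀ z : ℂ, z.re ≤ 0 → ‖H z‖ ≤ N := by
    intro z hz
    rw [← mul_one N]
    refine hgen z 1 ?_
    filter_upwards [h0] with x hx
    rw [Complex.norm_exp, Complex.re_mul_ofReal, Real.exp_le_one_iff]
    exact mul_nonpos_of_nonpos_of_nonneg hz hx
  have hlim' : Tendsto (fun s : ℝ => ‖H s‖) atTop (𝓝 0) := by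
    have := hlim.norm
    rw [norm_zero] at this
    simpa only [hreal, Complex.norm_real] using this
  have hright : ∀ z : ℂ, 0 ≤ z.re → ‖H z‖ ≤ N := by
    intro z hz
    refine PhragmenLindelof.right_half_plane_of_bounded_on_real hd.diffContOnCl
      ⟨1, by norm_num, M, ?_⟩ hlim'.isBoundedUnder_le (fun y => hleft _ (by simp)) hz
    refine Asymptotics.IsBigO.of_bound N (Eventually.of_forall fun z => ?_)
    rw [Real.norm_eq_abs, Real.abs_exp, Real.rpow_one]
    refine hgen z _ ?_
    filter_upwards [h0, hM] with x hx hx' using norm_exp_complex_le hx hx' z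
  have hbdd : Bornology.IsBounded (range H) := by
    refine isBounded_iff_forall_norm_le.2 ⟨N, ?_⟩
    rintro _ ⟨z, rfl⟩
    exact (le_total z.re 0).elim (hleft z) (hright z)
  have hconst : ∀ z w, H z = H w := hd.apply_eq_apply_of_bounded hbdd
  have hz : ‖H s‖ = 0 := by
    refine tendsto_nhds_unique (tendsto_const_nhds.congr fun r : ℝ => ?_) hlim'
    rw [hconst s r]
  rw [hreal, Complex.norm_real] at hz
  exact norm_eq_zero.1 hz

end ComplexMoments

/-! ### Exponential waves are complete -/

/-- An `L²` function orthogonal to all exponential waves with positive wave vector vanishes: after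
multiplication by `exp (x₀ + x₁ + x₂)` it is orthogonal to the algebra generated by the functions
`exp (x i)`, which is uniformly dense by the Stone–Weierstrass theorem. -/
theorem eq_zero_of_laplaceFunctional_eq_zero {v : L2}
    (h : ∀ α : Fin 3 → ℝ, (∀ i, 0 < α i) → laplaceFunctional α v = 0) : v = 0 := by
  set e : Fin 3 → C(Fin 3 → ℝ, ℝ) := fun i => ⟨fun x => Real.exp (x i), by fun_prop⟩
  set A := Algebra.adjoin ℝ (range e)
  set G : (Fin 3 → ℝ) → ℝ := fun x => v x * expWave 1 x
  have hG : Integrable G (volume.restrict unitCube) :=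
    integrable_mul_test v (contDiff_expWave 1).continuous
  have hGint : ∀ p : C(Fin 3 → ℝ, ℝ), Integrable (fun x => G x * p x)
      (volume.restrict unitCube) := by
    intro p
    obtain ⟨C, hC⟩ := exists_bound_Icc p.continuous
    exact hG.mul_bdd p.continuous.aestronglyMeasurable (ae_mem_Icc_unitCube.mono hC)
  have hmon : ∀ p ∈ Submonoid.closure (range e),
      ∃ α : Fin 3 → ℝ, 0 ≤ α ∧ ∀ x, p x = expWave α x := by
    intro p hp
    induction hp using Submonoid.closure_induction with
    | mem p hp =>
      obtain ⟨i, rfl⟩ := hp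
      refine ⟨Pi.single i 1, by simp, fun x => ?_⟩
      simp [e, expWave, Pi.single_apply]
    | one => exact ⟨0, le_rfl, fun x => by simp [expWave]⟩
    | mul p q _ _ hp hq =>
      obtain ⟨α, h1, h2⟩ := hp
      obtain ⟨β, h3, h4⟩ := hq
      refine ⟨α + β, add_nonneg h1 h3, fun x => ?_⟩
      rw [ContinuousMap.mul_apply, h2, h4, expWave, expWave, expWave, ← Real.exp_add,
        ← Finset.sum_add_distrib]
      simp only [Pi.add_apply, add_mul]
  have hA : ∀ p ∈ A, ∫ x in unitCube, G x * p x = 0 := by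
    intro p hp
    rw [← Subalgebra.mem_toSubmodule, Algebra.adjoin_eq_span] at hp
    induction hp using Submodule.span_induction with
    | mem p hp =>
      obtain ⟨α, h1, h2⟩ := hmon p hp
      rw [← h (1 + α) fun i => add_pos_of_pos_of_nonneg one_pos (h1 i), laplaceFunctional_apply]
      refine integral_congr_ae (ae_of_all _ fun x => ?_)
      simp only [G, h2, expWave, mul_assoc, ← Real.exp_add, ← Finset.sum_add_distrib,
        Pi.add_apply, add_mul]
    | zero => simp
    | add p q _ _ hp hq =>
      simp only [ContinuousMap.add_apply, mul_add]
      rw [integral_add (hGint p) (hGint q), hp, hq, add_zero]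
    | smul c p _ hp =>
      simp only [ContinuousMap.smul_apply, smul_eq_mul, mul_left_comm _ c]
      rw [integral_const_mul, hp, mul_zero]
  have hsep : A.SeparatesPoints := by
    intro x y hxy
    obtain ⟨i, hi⟩ := Function.ne_iff.1 hxy
    exact ⟨e i, ⟨e i, Algebra.subset_adjoin (mem_range_self i), rfl⟩,
      fun heq => hi (Real.exp_injective heq)⟩
  have hall : ∀ χ : C(Fin 3 → ℝ, ℝ), ∫ x in unitCube, G x * χ x = 0 := by
    intro χ
    set N := ∫ x in unitCube, |G x|
    have hN : 0 ≤ N := integral_nonneg fun _ => abs_nonneg _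
    have hb : ∀ ε > 0, |∫ x in unitCube, G x * χ x| ≤ N * ε := by
      intro ε hε
      obtain ⟨p, hp, hpχ⟩ :=
        ContinuousMap.exists_mem_subalgebra_near_continuous_of_isCompact_of_separatesPoints hsep χ
          (isCompact_Icc (a := (0 : Fin 3 → ℝ)) (b := 1)) hε
      rw [← sub_zero (∫ x in unitCube, G x * χ x), ← hA p hp,
        ← integral_sub (hGint χ) (hGint p), ← Real.norm_eq_abs, ← integral_mul_const]
      refine norm_integral_le_of_norm_le (hG.abs.mul_const ε) ?_
      filter_upwards [ae_mem_Icc_unitCube] with x hx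
      rw [← mul_sub, norm_mul, Real.norm_eq_abs (G x), norm_sub_rev]
      exact mul_le_mul_of_nonneg_left (hpχ x hx).le (abs_nonneg _)
    refine abs_eq_zero.1 (le_antisymm (le_of_forall_pos_le_add fun δ hδ => ?_) (abs_nonneg _))
    rw [zero_add]
    refine (hb (δ / (N + 1)) (by positivity)).trans ?_
    rw [mul_div_assoc', div_le_iff₀ (by positivity)]
    nlinarith
  have hG0 := isOpen_unitCube.ae_eq_zero_of_integral_contDiff_smul_eq_zero (μ := volume)
    (f := G) (IntegrableOn.locallyIntegrableOn hG) fun χ h1 h2 h3 => by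
      rw [← hall ⟨χ, h1.continuous⟩]
      rw [setIntegral_eq_integral_of_forall_compl_eq_zero]
      · exact integral_congr_ae (ae_of_all _ fun x => mul_comm _ _)
      · intro x hx
        have : χ x = 0 := by
          by_contra hne
          exact hx (h3 (subset_tsupport χ hne))
        simp [this]
  apply Lp.ext
  refine EventuallyEq.trans ?_ (Lp.coeFn_zero _ _ _).symm
  rw [Filter.EventuallyEq, ae_restrict_iff' isOpen_unitCube.measurableSet]
  filter_upwards [hG0] with x hx hm
  exact (mul_eq_zero.1 (hx hm)).resolve_right (Real.exp_pos _).ne'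

/-- The longitudinal and transverse polarizations together detect every vector field. -/
theorem eq_zero_of_waveFunctional_eq_zero {v : Fin 3 → L2}
    (hl : ∀ α : Fin 3 → ℝ, (∀ i, 0 < α i) → waveFunctional α α v = 0)
    (ht : ∀ α a : Fin 3 → ℝ, (∀ i, 0 < α i) → ∑ j, a j * α j = 0 → waveFunctional α a v = 0) :
    v = 0 := by
  funext k
  refine eq_zero_of_laplaceFunctional_eq_zero fun α hα => ?_
  have hn : 0 < ∑ i, α i ^ 2 := Finset.sum_pos (fun i _ => pow_pos (hα i) 2) Finset.univ_nonempty
  -- The unit vector `e k` times `|α|²` is `α k • α` plus a vector orthogonal to `α`.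
  have h1 := hl α hα
  have h2 := ht α (fun j => (if j = k then ∑ i, α i ^ 2 else 0) - α k * α j) hα (by
    simp only [sub_mul, ite_mul, zero_mul, Finset.sum_sub_distrib, Finset.sum_ite_eq',
      Finset.mem_univ, if_true, mul_assoc, ← Finset.mul_sum, ← pow_two]
    ring)
  rw [waveFunctional_apply] at h1 h2
  simp only [sub_mul, ite_mul, zero_mul, Finset.sum_sub_distrib, Finset.sum_ite_eq',
    Finset.mem_univ, if_true, mul_assoc, ← Finset.mul_sum, h1, mul_zero, sub_zero] at h2
  exact (mul_eq_zero.1 h2).resolve_left hn.ne'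

/-! ### Uniqueness -/

section Uniqueness

variable {lam mu T : ℝ} {φ : ℝ → ℝ} {X : ℝ → Fin 3 → Lp ℝ 1 surfaceMeasure} {g h : Fin 3 → L2}
  {u₁ u₂ : ℝ → Fin 3 → L2} {f₁ f₂ : Fin 3 → L2}

theorem hasDerivWithinAt_waveFunctional_sub {w₁ w₂ : ℝ → Fin 3 → L2} {w₁' w₂' : Fin 3 → L2}
    {s : Set ℝ} {t : ℝ} (h₁ : HasDerivWithinAt w₁ w₁' s t) (h₂ : HasDerivWithinAt w₂ w₂' s t)
    (α a : Fin 3 → ℝ) :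
    HasDerivWithinAt (fun t => waveFunctional α a (w₁ t - w₂ t)) (waveFunctional α a (w₁' - w₂'))
      s t :=
  (waveFunctional α a).hasFDerivAt.comp_hasDerivWithinAt t (h₁.sub h₂)

/-- Duhamel's formula for the mode `(α, a)` of the difference of two solutions with the same data:
the unknown boundary stress and the initial values cancel. -/
theorem IsSolution.waveFunctional_sub_eq_integral (hT : 0 < T)
    (hsol₁ : IsSolution lam mu T φ X g h u₁ f₁) (hsol₂ : IsSolution lam mu T φ X g h u₂ f₂)
    {κ c : ℝ} {α a : Fin 3 → ℝ} (hmode : IsLameMode lam mu κ α a)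
    (hc : c ^ 2 = κ * ∑ i, α i ^ 2) {t : ℝ} (ht : t ∈ Icc 0 T) :
    (waveFunctional α a (derivWithin u₁ (Icc 0 T) t - derivWithin u₂ (Icc 0 T) t) +
        c * waveFunctional α a (u₁ t - u₂ t)) * Real.exp (-c * t) =
      waveFunctional α a (f₁ - f₂) * ∫ s in 0..t, φ s * Real.exp (-c * s) := by
  obtain ⟨d₁, e₁, k₁⟩ := hasDerivWithinAt_of_contDiffOn_two hT hsol₁.contDiffOn
  obtain ⟨d₂, e₂, k₂⟩ := hasDerivWithinAt_of_contDiffOn_two hT hsol₂.contDiffOn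
  refine exp_mul_eq_integral_of_ode
    (W := fun t => waveFunctional α a (u₁ t - u₂ t))
    (W₁ := fun t => waveFunctional α a (derivWithin u₁ (Icc 0 T) t - derivWithin u₂ (Icc 0 T) t))
    (fun s hs => hasDerivWithinAt_waveFunctional_sub (d₁ s hs) (d₂ s hs) α a)
    (fun s hs => hasDerivWithinAt_waveFunctional_sub (e₁ s hs) (e₂ s hs) α a)
    ((waveFunctional α a).continuous.comp_continuousOn (k₁.sub k₂)) ?_ ?_ ?_ ht
  · filter_upwards [hsol₁.waveFunctional_equation hmode, hsol₂.waveFunctional_equation hmode]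
      with s h₁ h₂
    simp only [map_sub, hc]
    linear_combination h₁ - h₂
  · simp [hsol₁.initial_value, hsol₂.initial_value]
  · simp [hsol₁.initial_velocity, hsol₂.initial_velocity]

/-- A form of the Cauchy–Schwarz inequality, with the constant `√3` replaced by `2`. -/
theorem sum_le_two_mul_sqrt (α : Fin 3 → ℝ) : ∑ i, α i ≤ 2 * √(∑ i, α i ^ 2) := by
  rw [← Real.sqrt_sq (zero_le_two : (0 : ℝ) ≤ 2), ← Real.sqrt_mul (by positivity)]
  refine Real.le_sqrt_of_sq_le ?_
  simp only [Fin.sum_univ_three]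
  nlinarith [sq_nonneg (α 0 - α 1), sq_nonneg (α 0 - α 2), sq_nonneg (α 1 - α 2), sq_nonneg (α 0),
    sq_nonneg (α 1), sq_nonneg (α 2)]

/-- The decay in time of the mode beats its growth in space: `√κ T > 2` exceeds the ratio of
`∑ i, α i`, the maximum of `α · x` on the cube, to the length of `α`. -/
theorem IsSolution.tendsto_waveFunctional_sub (hT : 0 < T) (hφ : IntegrableOn φ (Ioo 0 T))
    (hW1 : ∃ Λ ∈ Ioo 0 T, ∃ C > 0,
      (∀ᵐ t ∂volume.restrict (Ioo 0 Λ), C ≤ φ t) ∨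
      (∀ᵐ t ∂volume.restrict (Ioo 0 Λ), φ t ≤ -C))
    (hsol₁ : IsSolution lam mu T φ X g h u₁ f₁) (hsol₂ : IsSolution lam mu T φ X g h u₂ f₂)
    {κ : ℝ} (hκ : 0 < κ) (hκT : 2 < √κ * T) {α a : Fin 3 → ℝ} (hα : ∀ i, 0 < α i)
    (hmode : IsLameMode lam mu κ α a) :
    Tendsto (fun s : ℝ => waveFunctional (s • α) a (f₁ - f₂)) atTop (𝓝 0) := by
  obtain ⟨K, hK, hφK⟩ := exists_le_mul_abs_integral_exp hφ hW1
  have hn : 0 < ∑ i, α i ^ 2 := Finset.sum_pos (fun i _ => pow_pos (hα i) 2) Finset.univ_nonempty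
  set β := √κ * √(∑ i, α i ^ 2) with hβdef
  have hβ : 0 < β := mul_pos (Real.sqrt_pos.2 hκ) (Real.sqrt_pos.2 hn)
  have hβ2 : β ^ 2 = κ * ∑ i, α i ^ 2 := by
    rw [hβdef, mul_pow, Real.sq_sqrt hκ.le, Real.sq_sqrt hn.le]
  -- `δ` is the net rate of decay along the ray: time decay minus spatial growth.
  set δ := β * T - ∑ i, α i with hδdef
  have hδ : 0 < δ := by
    have h1 := sum_le_two_mul_sqrt α
    have h2 := mul_lt_mul_of_pos_right hκT (Real.sqrt_pos.2 hn)
    rw [hδdef, hβdef]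
    linarith
  set N : (Fin 3 → L2) → ℝ := fun v => ∑ j, |a j| * ∫ x in unitCube, |v j x|
  set w := u₁ T - u₂ T
  set w' := derivWithin u₁ (Icc 0 T) T - derivWithin u₂ (Icc 0 T) T
  have hbound : ∀ᶠ s : ℝ in atTop, ‖waveFunctional (s • α) a (f₁ - f₂)‖ ≤
      (β * s * (N w' + β * s * N w) * Real.exp (-(δ * s))) / K := by
    filter_upwards [(tendsto_id.const_mul_atTop hβ).eventually hφK, eventually_gt_atTop 0]
      with s hs h0
    have hβs : 0 < β * s := mul_pos hβ h0
    have hsα : 0 ≤ s • α := fun i => mul_nonneg h0.le (hα i).le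
    have hsum : ∑ i, (s • α) i = s * ∑ i, α i := by simp [Finset.mul_sum]
    have hduh := hsol₁.waveFunctional_sub_eq_integral hT hsol₂ (hmode.smul s) (c := β * s)
      (by rw [mul_pow, hβ2]; simp only [Pi.smul_apply, smul_eq_mul, mul_pow, ← Finset.mul_sum]
          ring) (right_mem_Icc.2 hT.le)
    have hb' := abs_waveFunctional_le hsα a w'
    have hb := abs_waveFunctional_le hsα a w
    rw [hsum] at hb hb'
    simp only [id] at hs
    rw [le_div_iff₀ hK, Real.norm_eq_abs]
    calc |waveFunctional (s • α) a (f₁ - f₂)| * K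
        ≤ |waveFunctional (s • α) a (f₁ - f₂)| *
          (β * s * |∫ t in 0..T, φ t * Real.exp (-(β * s) * t)|) :=
          mul_le_mul_of_nonneg_left hs (abs_nonneg _)
      _ = β * s * |(waveFunctional (s • α) a w' + β * s * waveFunctional (s • α) a w) *
          Real.exp (-(β * s) * T)| := by
          rw [hduh, abs_mul]
          ring
      _ ≤ β * s * ((Real.exp (s * ∑ i, α i) * N w' + β * s * (Real.exp (s * ∑ i, α i) * N w)) *
          Real.exp (-(β * s) * T)) := by
          rw [abs_mul, Real.abs_exp]
          refine mul_le_mul_of_nonneg_left (mul_le_mul_of_nonneg_right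
            ((abs_add_le _ _).trans (add_le_add hb' ?_)) (Real.exp_pos _).le) hβs.le
          rw [abs_mul, abs_of_pos hβs]
          exact mul_le_mul_of_nonneg_left hb hβs.le
      _ = β * s * (N w' + β * s * N w) * Real.exp (-(δ * s)) := by
          have : Real.exp (-(δ * s)) =
              Real.exp (s * ∑ i, α i) * Real.exp (-(β * s) * T) := by
            rw [← Real.exp_add, hδdef]
            congr 1
            ring
          rw [this]
          ring
  refine squeeze_zero_norm' hbound ?_
  have lδ : Tendsto (fun s : ℝ => δ * s) atTop atTop := tendsto_id.const_mul_atTop hδ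
  have l1 := (Real.tendsto_pow_mul_exp_neg_atTop_nhds_zero 1).comp lδ
  have l2 := (Real.tendsto_pow_mul_exp_neg_atTop_nhds_zero 2).comp lδ
  have := (l1.const_mul (β * N w' / δ / K)).add (l2.const_mul (β ^ 2 * N w / δ ^ 2 / K))
  simp only [mul_zero, add_zero] at this
  refine this.congr fun s => ?_
  simp only [Function.comp, pow_one]
  field_simp

theorem waveFunctional_smul_eq_integral (α a : Fin 3 → ℝ) (v : Fin 3 → L2) (s : ℝ) :
    waveFunctional (s • α) a v =
      ∫ x in unitCube, (∑ j, a j * v j x) * Real.exp (s * ∑ i, α i * x i) := by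
  rw [waveFunctional_apply]
  simp only [laplaceFunctional_apply, ← integral_const_mul]
  rw [← integral_finsetSum _ fun j _ =>
    (integrable_mul_test (v j) (contDiff_expWave (s • α)).continuous).const_mul (a j)]
  refine integral_congr_ae (ae_of_all _ fun x => ?_)
  simp only [expWave, Pi.smul_apply, smul_eq_mul, Finset.sum_mul, Finset.mul_sum, mul_assoc]

/-- The two body forces agree on every mode, since along the ray `s • α` their difference is an
exponential moment that decays as `s → ∞`. -/
theorem IsSolution.waveFunctional_source_sub_eq_zero (hT : 0 < T) (hφ : IntegrableOn φ (Ioo 0 T))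
    (hW1 : ∃ Λ ∈ Ioo 0 T, ∃ C > 0,
      (∀ᵐ t ∂volume.restrict (Ioo 0 Λ), C ≤ φ t) ∨
      (∀ᵐ t ∂volume.restrict (Ioo 0 Λ), φ t ≤ -C))
    (hsol₁ : IsSolution lam mu T φ X g h u₁ f₁) (hsol₂ : IsSolution lam mu T φ X g h u₂ f₂)
    {κ : ℝ} (hκ : 0 < κ) (hκT : 2 < √κ * T) {α a : Fin 3 → ℝ} (hα : ∀ i, 0 < α i)
    (hmode : IsLameMode lam mu κ α a) : waveFunctional α a (f₁ - f₂) = 0 := by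
  have hlim := hsol₁.tendsto_waveFunctional_sub hT hφ hW1 hsol₂ hκ hκT hα hmode
  simp only [waveFunctional_smul_eq_integral] at hlim
  rw [← one_smul ℝ α, waveFunctional_smul_eq_integral]
  refine integral_mul_exp_eq_zero_of_tendsto (M := ∑ i, α i)
    (integrable_finsetSum _ fun j _ => (integrable_L2 _).const_mul _)
    (Continuous.aemeasurable (by fun_prop)) ?_ ?_ hlim 1
  · filter_upwards [ae_mem_Icc_unitCube] with x hx using
      Finset.sum_nonneg fun i _ => mul_nonneg (hα i).le (hx.1 i)
  · filter_upwards [ae_mem_Icc_unitCube] with x hx using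
      Finset.sum_le_sum fun i _ => mul_le_of_le_one_right (hα i).le (hx.2 i)

/-- With equal body forces, Duhamel's formula reduces to `W' + c W = 0` for each mode `W` of the
difference, so no energy estimate is needed. -/
theorem IsSolution.waveFunctional_sub_eq_zero (hT : 0 < T)
    {f : Fin 3 → L2} (hsol₁ : IsSolution lam mu T φ X g h u₁ f)
    (hsol₂ : IsSolution lam mu T φ X g h u₂ f) {κ : ℝ} (hκ : 0 < κ) {α a : Fin 3 → ℝ}
    (hmode : IsLameMode lam mu κ α a) {t : ℝ} (ht : t ∈ Icc 0 T) :
    waveFunctional α a (u₁ t - u₂ t) = 0 := by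
  obtain ⟨d₁, -, -⟩ := hasDerivWithinAt_of_contDiffOn_two hT hsol₁.contDiffOn
  obtain ⟨d₂, -, -⟩ := hasDerivWithinAt_of_contDiffOn_two hT hsol₂.contDiffOn
  refine eq_zero_of_deriv_add_mul_eq_zero (c := √(κ * ∑ i, α i ^ 2))
    (W := fun t => waveFunctional α a (u₁ t - u₂ t))
    (fun s hs => hasDerivWithinAt_waveFunctional_sub (d₁ s hs) (d₂ s hs) α a)
    (fun s hs => ?_) (by simp [hsol₁.initial_value, hsol₂.initial_value]) ht
  have := hsol₁.waveFunctional_sub_eq_integral hT hsol₂ hmode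
    (Real.sq_sqrt (mul_nonneg hκ.le (Finset.sum_nonneg fun i _ => sq_nonneg (α i)))) hs
  rw [sub_self, map_zero, zero_mul] at this
  exact (mul_eq_zero.1 this).resolve_right (Real.exp_pos _).ne'

end Uniqueness

end Lame

theorem theorem1 (lam mu T : ℝ) (hmu : 0 < mu) (hlam : 0 < lam + 2 * mu)
    (φ : ℝ → ℝ) (hφ : IntegrableOn φ (Ioo 0 T))
    (X : ℝ → Fin 3 → Lp ℝ 1 Lame.surfaceMeasure) (hX : IntegrableOn X (Ioo 0 T))
    (g h : Fin 3 → Lame.L2)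
    (hW1 : ∃ Λ ∈ Ioo 0 T, ∃ C > 0,
      (∀ᵐ t ∂volume.restrict (Ioo 0 Λ), C ≤ φ t) ∨
      (∀ᵐ t ∂volume.restrict (Ioo 0 Λ), φ t ≤ -C))
    (hW2 : 2 * max (1 / Real.sqrt mu) (1 / Real.sqrt (lam + 2 * mu)) < T)
    (u₁ u₂ : ℝ → Fin 3 → Lame.L2) (f₁ f₂ : Fin 3 → Lame.L2)
    (hsol₁ : Lame.IsSolution lam mu T φ X g h u₁ f₁)
    (hsol₂ : Lame.IsSolution lam mu T φ X g h u₂ f₂) :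
    EqOn u₁ u₂ (Icc 0 T) ∧ f₁ = f₂ := by
  have hT : 0 < T := by
    obtain ⟨Λ, hΛ, -⟩ := hW1
    exact hΛ.1.trans hΛ.2
  have speed : ∀ κ : ℝ, 0 < κ →
      1 / √κ ≤ max (1 / Real.sqrt mu) (1 / Real.sqrt (lam + 2 * mu)) → 2 < √κ * T := by
    intro κ hκ hle
    have h1 : 2 * (1 / √κ) < T := by linarith
    rw [mul_one_div, div_lt_iff₀ (Real.sqrt_pos.2 hκ)] at h1
    linarith
  have hf : f₁ = f₂ := sub_eq_zero.1 <| Lame.eq_zero_of_waveFunctional_eq_zero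
    (fun α hα => hsol₁.waveFunctional_source_sub_eq_zero hT hφ hW1 hsol₂ hlam
      (speed _ hlam (le_max_right _ _)) hα (Lame.isLameMode_longitudinal lam mu α))
    (fun α a hα ha => hsol₁.waveFunctional_source_sub_eq_zero hT hφ hW1 hsol₂ hmu
      (speed _ hmu (le_max_left _ _)) hα (Lame.isLameMode_transverse lam mu ha))
  subst hf
  refine ⟨fun t ht => sub_eq_zero.1 <| Lame.eq_zero_of_waveFunctional_eq_zero
    (fun α _ => hsol₁.waveFunctional_sub_eq_zero hT hsol₂ hlam
      (Lame.isLameMode_longitudinal lam mu α) ht)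
    (fun α a _ ha => hsol₁.waveFunctional_sub_eq_zero hT hsol₂ hmu
      (Lame.isLameMode_transverse lam mu ha) ht), rfl⟩
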